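/- For $1\le p<\infty$ and $x\in\mathbb R^n$ let $\|x\|_p=\left(\frac1n\sum_{i=1}^n|x_i|^p\right)^{1/p}$ be the normalized $p$-norm, and let $\|x\|_\infty=\max_i|x_i|$. A function $f:[0,1]^n\to[0,1]^m$ is $\lambda$-Lipschitz (in $\ell_p$) if $\|f(x)-f(y)\|_p\le\lambda\|x-y\|_p$ for all $x,y\in[0,1]^n$. Consider the following two-player search problems; in each of them player $A$ knows only $f_A$, player $B$ knows only $f_B$, where $f_A$ is $\lambda_A$-Lipschitz and $f_B$ is $\lambda_B$-Lipschitz, all other parameters are public, and the players must output some $x\in[0,1]^n$ with $\|f(x)-x\|_p\le\varepsilon$ for the function $f:[0,1]^n\to[0,1]^n$ indicated: - $\mathsf{Comp}_{p,n,m,\varepsilon,\lambda_A,\lambda_B}$: $f_A:[0,1]^n\to[0,1]^m$, $f_B:[0,1]^m\to[0,1]^n$, and $f=f_B\circ f_A$; - $\mathsf{Concat}_{p,n,\varepsilon,\lambda_A,\lambda_B}$ ($n$ even): $f_A,f_B:[0,1]^n\to[0,1]^{n/2}$, and $f=(f_A,f_B)$; - $\mathsf{Mean}_{p,n,\varepsilon,\lambda_A,\lambda_B}$: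 $f_A,f_B:[0,1]^n\to[0,1]^n$, and $f=\frac{f_A+f_B}{2}$. Let $\mathsf{CC}$ denote deterministic communication complexity: the minimum, over all deterministic two-party protocols (binary protocol trees, with an output $x$ at each leaf) that output a valid answer on every pair of inputs, of the worst-case number of bits exchanged. **Lemma.** Let $\varepsilon,\lambda_A,\lambda_B>0$ be constants. For every constant $K\in\mathbb N$ there is a constant $C$, depending only on $\varepsilon,\lambda_A,\lambda_B,K$, such that for all $p\in[1,\infty]$, all $n\ge1$ and all $m\le Kn$, $$\mathsf{CC}(\mathsf{Comp}_{p,n,m,\varepsilon,\lambda_A,\lambda_B})\le 2^{Cn}.$$ Moreover, there are constants $C',C''$, depending only on $\varepsilon,\lambda_A,\lambda_B$, such that for all $p\in[1,\infty]$, $\mathsf{CC}(\mathsf{Concat}_{p,n,\varepsilon,\lambda_A,\lambda_B})\le 2^{C'n}$ for all even $n\ge2$, and $\mathsf{CC}(\mathsf{Mean}_{p,n,\varepsilon,\lambda_A,\lambda_B})\le 2^{C''n}$ for all $n\ge1$. That is, all three problems have deterministic communication complexity $2^{O(n)}$, uniformly in $p$. -/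

import Mathlib

open scoped ENNReal

namespace BrouwerComm

/-! ### Two-party deterministic communication -/

/-- A deterministic two-party protocol tree. At an inner node its owner sends one bit, which depends
on the owner's own input (and on the node, that is, on the bits sent so far); a leaf carries the
common output. Inputs are arbitrary types, possibly infinite. -/
inductive Protocol (X Y Z : Type) : Type
  | output (z : Z) : Protocol X Y Z
  | alice (bit : X → Bool) (next : Bool → Protocol X Y Z) : Protocol X Y Z
  | bob (bit : Y → Bool) (next : Bool → Protocol X Y Z) : Protocol X Y Z

/-- The output of the protocol on the input pair `(x, y)`. -/
def Protocol.run {X Y Z : Type} : Protocol X Y Z → X → Y → Z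
  | .output z, _, _ => z
  | .alice bit next, x, y => (next (bit x)).run x y
  | .bob bit next, x, y => (next (bit y)).run x y

/-- The cost of a protocol: the depth of the tree, i.e. the number of bits sent in the worst case. -/
def Protocol.cost {X Y Z : Type} : Protocol X Y Z → ℕ
  | .output _ => 0
  | .alice _ next => 1 + max (next false).cost (next true).cost
  | .bob _ next => 1 + max (next false).cost (next true).cost

/-- The protocol solves the search problem `R`: on every pair of inputs it outputs a valid answer. -/
def Protocol.Solves {X Y Z : Type} (P : Protocol X Y Z) (R : X → Y → Z → Prop) : Prop :=
  ∀ x y, R x y (P.run x y)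

/-- Deterministic communication complexity of a search problem: the least cost of a protocol
solving it (`⊤` if there is none). -/
noncomputable def detCC {X Y Z : Type} (R : X → Y → Z → Prop) : ℕ∞ :=
  ⨅ (P : Protocol X Y Z) (_ : P.Solves R), (P.cost : ℕ∞)

/-! ### Normalized norms, the cube, Lipschitz maps -/

/-- The normalized `p`-norm on `ℝⁿ` for `1 ≤ p < ∞`, and the max norm for `p = ∞`. -/
noncomputable def pNorm (p : ℝ≥0∞) {n : ℕ} (x : Fin n → ℝ) : ℝ :=
  if p = ∞ then ⨆ i, |x i|
  else ((1 / (n : ℝ)) * ∑ i, |x i| ^ p.toReal) ^ (1 / p.toReal)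

/-- The cube `[0,1]ⁿ`. -/
abbrev Cube (n : ℕ) : Type := {x : Fin n → ℝ // ∀ i, x i ∈ Set.Icc (0 : ℝ) 1}

/-- `f : [0,1]ⁿ → [0,1]ᵐ` is `lam`-Lipschitz in the (normalized) `p`-norm. -/
def IsLipschitz (p : ℝ≥0∞) (lam : ℝ) {n m : ℕ} (f : Cube n → Cube m) : Prop :=
  ∀ x y : Cube n, pNorm p ((f x).1 - (f y).1) ≤ lam * pNorm p (x.1 - y.1)

/-- The `lam`-Lipschitz functions `[0,1]ⁿ → [0,1]ᵐ` in the `p`-norm: a player's possible inputs. -/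
abbrev LipFun (p : ℝ≥0∞) (lam : ℝ) (n m : ℕ) : Type := {f : Cube n → Cube m // IsLipschitz p lam f}

/-- `x` is an `eps`-approximate fixed point of `f` in the `p`-norm. -/
def IsApproxFixedPoint (p : ℝ≥0∞) (eps : ℝ) {n : ℕ} (f : Cube n → Cube n) (x : Cube n) : Prop :=
  pNorm p ((f x).1 - x.1) ≤ eps

/-! ### The three Brouwer problems -/

/-- `f_Comp = f_B ∘ f_A`. -/
def compMap {n m : ℕ} (fA : Cube n → Cube m) (fB : Cube m → Cube n) : Cube n → Cube n :=
  fun x => fB (fA x)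

/-- `f_Concat = (f_A, f_B)`. -/
def concatMap {k : ℕ} (fA fB : Cube (k + k) → Cube k) : Cube (k + k) → Cube (k + k) :=
  fun x => ⟨Fin.append (fA x).1 (fB x).1, fun i => by
    refine Fin.addCases (fun j => ?_) (fun j => ?_) i
    · rw [Fin.append_left]; exact (fA x).2 j
    · rw [Fin.append_right]; exact (fB x).2 j⟩

/-- `f_Mean = (f_A + f_B) / 2`. -/
noncomputable def meanMap {n : ℕ} (fA fB : Cube n → Cube n) : Cube n → Cube n :=
  fun x => ⟨fun i => ((fA x).1 i + (fB x).1 i) / 2, fun i => by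
    have h1 := (fA x).2 i
    have h2 := (fB x).2 i
    rw [Set.mem_Icc] at h1 h2 ⊢
    constructor <;> linarith⟩

/-- The Composition Brouwer problem. -/
def CompProblem (p : ℝ≥0∞) (n m : ℕ) (eps lamA lamB : ℝ) :
    LipFun p lamA n m → LipFun p lamB m n → Cube n → Prop :=
  fun fA fB x => IsApproxFixedPoint p eps (compMap fA.1 fB.1) x

/-- The Concatenation Brouwer problem in the even dimension `n = k + k`. -/
def ConcatProblem (p : ℝ≥0∞) (k : ℕ) (eps lamA lamB : ℝ) :
    LipFun p lamA (k + k) k → LipFun p lamB (k + k) k → Cube (k + k) → Prop :=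
  fun fA fB x => IsApproxFixedPoint p eps (concatMap fA.1 fB.1) x

/-- The Mean Brouwer problem. -/
def MeanProblem (p : ℝ≥0∞) (n : ℕ) (eps lamA lamB : ℝ) :
    LipFun p lamA n n → LipFun p lamB n n → Cube n → Prop :=
  fun fA fB x => IsApproxFixedPoint p eps (meanMap fA.1 fB.1) x

end BrouwerComm

/-! Alice rounds the values of her function on the grid of mesh `1/N` and sends the whole table.
Bob, who can then evaluate the combined map up to a small error, names a grid point that it nearly
fixes. The normalized norm never exceeds the max norm, so rounding costs at most `1/N` whatever the
dimension and `p`. Hence `N` can be chosen from `eps`, `lamA`, `lamB` alone, and a table of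
`(N+1)^n` entries takes `2^O(n)` bits. All three problems are instances of `detCC_le_of_table`.

Bob has an answer because of Brouwer's theorem in approximate form, deduced from Kuhn's lemma by a
parity count. The cup product of the label coboundaries is itself a coboundary, so a discrete Stokes
formula reduces its sum over the lattice box to the sum over one upper face with one label fewer,
and by induction to 1. A cube where the product is nonzero carries both values of every label, which
forces every coordinate of the displacement to be small there. -/

namespace BrouwerComm

/-! ### A cubical cup product and Kuhn's lemma -/

section Kuhn

variable {ι : Type} [DecidableEq ι]

/-- The cubical cup product modulo 2 of the coboundaries of the labels `l i`, `i ∈ L`, evaluated on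
the lattice cube with least vertex `x` and directions `S`. -/
def cup (l : ι → (ι → ℕ) → ZMod 2) : List ι → Finset ι → (ι → ℕ) → ZMod 2
  | [], S, _ => if S = ∅ then 1 else 0
  | i :: L, S, x => ∑ a ∈ S, (l i (x + Pi.single a 1) + l i x) * cup l L (S.erase a) (x + Pi.single a 1)

/-- The ordered pairs `(a, b)` and `(b, a)` cancel in characteristic 2; this is the source of `d² =
0`. -/
lemma sum_erase_comm_eq_zero (S : Finset ι) (f : ι → ι → ZMod 2) (hf : ∀ a b, f a b = f b a) :
    ∑ a ∈ S, ∑ b ∈ S.erase a, f a b = 0 := by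
  induction S using Finset.induction_on with
  | empty => simp
  | insert c S hc ih =>
    rw [Finset.sum_insert hc, Finset.erase_insert hc]
    have h : ∀ a ∈ S, ∑ b ∈ (insert c S).erase a, f a b = f a c + ∑ b ∈ S.erase a, f a b := by
      intro a ha
      have hac : c ≠ a := fun h => hc (h ▸ ha)
      rw [Finset.erase_insert_of_ne hac, Finset.sum_insert (by simp [hc])]
    rw [Finset.sum_congr rfl h, Finset.sum_add_distrib, ih, add_zero, ← Finset.sum_add_distrib]
    exact Finset.sum_eq_zero fun a _ => by rw [hf c a]; exact CharTwo.add_self_eq_zero _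

/-- The cup product of coboundaries is closed. -/
lemma cup_closed (l : ι → (ι → ℕ) → ZMod 2) (L : List ι) (S : Finset ι) (x : ι → ℕ) :
    ∑ a ∈ S, (cup l L (S.erase a) (x + Pi.single a 1) + cup l L (S.erase a) x) = 0 := by
  induction L generalizing S x with
  | nil => exact Finset.sum_eq_zero fun a _ => CharTwo.add_self_eq_zero _
  | cons i L ih =>
    -- Modulo 2, closedness says that the front facets and the back facets have equal sums.
    have ih' : ∀ S : Finset ι, ∀ x, ∑ a ∈ S, cup l L (S.erase a) x
        = ∑ a ∈ S, cup l L (S.erase a) (x + Pi.single a 1) := by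
      intro S x
      have := ih S x
      rw [Finset.sum_add_distrib] at this
      exact (CharTwo.add_eq_zero.mp this).symm
    simp only [cup]
    rw [Finset.sum_add_distrib]
    have swap : ∑ a ∈ S, ∑ b ∈ S.erase a,
          (l i (x + Pi.single b 1) + l i x) * cup l L ((S.erase a).erase b) (x + Pi.single b 1)
        = ∑ b ∈ S, ∑ a ∈ S.erase b, (l i (x + Pi.single b 1) + l i x) *
            cup l L ((S.erase b).erase a) (x + Pi.single b 1) := by
      rw [Finset.sum_comm' (t' := S) (s' := fun b => S.erase b)]
      · exact Finset.sum_congr rfl fun b _ => Finset.sum_congr rfl fun a _ => by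
          rw [Finset.erase_right_comm]
      · intro a b
        simp only [Finset.mem_erase]
        tauto
    rw [swap, ← Finset.sum_add_distrib]
    -- After `ih'` moves the second sum to the far facets, the label differences along the edges `x
    -- → x+a → x+a+b` telescope to one from `x` to `x+a+b`, which is symmetric in `a` and `b`.
    have step : ∀ a ∈ S, (∑ b ∈ S.erase a, (l i (x + Pi.single a 1 + Pi.single b 1)
            + l i (x + Pi.single a 1)) * cup l L ((S.erase a).erase b)
              (x + Pi.single a 1 + Pi.single b 1)
          + ∑ b ∈ S.erase a, (l i (x + Pi.single a 1) + l i x) *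
            cup l L ((S.erase a).erase b) (x + Pi.single a 1))
        = ∑ b ∈ S.erase a, (l i (x + Pi.single a 1 + Pi.single b 1) + l i x) *
            cup l L ((S.erase a).erase b) (x + Pi.single a 1 + Pi.single b 1) := by
      intro a _
      rw [← Finset.mul_sum, ih', Finset.mul_sum, ← Finset.sum_add_distrib]
      refine Finset.sum_congr rfl fun b _ => ?_
      rw [← add_mul]
      congr 1
      rw [add_assoc, ← add_assoc (l i (x + Pi.single a 1)), CharTwo.add_self_eq_zero, zero_add]
    rw [Finset.sum_congr rfl step]
    refine sum_erase_comm_eq_zero S (fun a b => (l i (x + Pi.single a 1 + Pi.single b 1) + l i x) *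
            cup l L ((S.erase a).erase b) (x + Pi.single a 1 + Pi.single b 1)) fun a b => ?_
    rw [add_right_comm, Finset.erase_right_comm]

/-- The cup product is the coboundary of its first label times the remaining factors. -/
lemma cup_cons_eq (l : ι → (ι → ℕ) → ZMod 2) (i : ι) (L : List ι) (S : Finset ι) (x : ι → ℕ) :
    cup l (i :: L) S x = ∑ a ∈ S, (l i (x + Pi.single a 1) * cup l L (S.erase a) (x + Pi.single a 1)
      - l i x * cup l L (S.erase a) x) := by
  -- Leibniz rule: the missing term is `l i x` times the coboundary of the remaining product, which
  -- vanishes.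
  have h := congrArg (l i x * ·) (cup_closed l L S x)
  simp only [Finset.mul_sum, mul_zero] at h
  rw [← sub_zero (cup l (i :: L) S x), ← h, cup, ← Finset.sum_sub_distrib]
  refine Finset.sum_congr rfl fun a _ => ?_
  simp only [CharTwo.sub_eq_add]
  linear_combination (l i x * cup l L (S.erase a) (x + Pi.single a 1)) *
    (CharTwo.two_eq_zero : (2 : ZMod 2) = 0)

/-- A nonzero product has a nonzero term, that is, a monotone edge path in the cube along which each
label in turn changes. Keeping track of the directions `S` matters: on a face orthogonal to `a` the
witnesses have the same `a`-coordinate. -/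
lemma exists_label_ne_of_cup_ne_zero (l : ι → (ι → ℕ) → ZMod 2) {L : List ι} {S : Finset ι}
    {x : ι → ℕ} (h : cup l L S x ≠ 0) {i : ι} (hi : i ∈ L) :
    ∃ u v : ι → ℕ, l i u ≠ l i v ∧ (∀ j, x j ≤ u j ∧ u j ≤ x j + if j ∈ S then 1 else 0) ∧
      (∀ j, x j ≤ v j ∧ v j ≤ x j + if j ∈ S then 1 else 0) := by
  induction L generalizing S x with
  | nil => simp at hi
  | cons k L ih =>
    rw [cup] at h
    obtain ⟨a, ha, hne⟩ := Finset.exists_ne_zero_of_sum_ne_zero h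
    rcases List.mem_cons.mp hi with rfl | hi
    · refine ⟨x + Pi.single a 1, x, fun he => hne ?_, fun j => ?_, fun j => ?_⟩
      · rw [he, CharTwo.add_self_eq_zero, zero_mul]
      · by_cases hj : j = a
        · subst hj; simp [ha]
        · simp [hj]
      · simp
    · obtain ⟨u, v, huv, hu, hv⟩ := ih (right_ne_zero_of_mul hne) hi
      have key : ∀ w : ι → ℕ, (∀ j, (x + Pi.single a 1 : ι → ℕ) j ≤ w j ∧
          w j ≤ (x + Pi.single a 1 : ι → ℕ) j + if j ∈ S.erase a then 1 else 0) →
          ∀ j, x j ≤ w j ∧ w j ≤ x j + if j ∈ S then 1 else 0 := by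
        intro w hw j
        have := hw j
        by_cases hj : j = a
        · subst hj
          simp only [Pi.add_apply, Pi.single_eq_same, Finset.mem_erase, ne_eq, not_true_eq_false,
            false_and, if_false] at this
          simp only [ha, if_true]
          omega
        · simpa [hj] using this
      exact ⟨u, v, huv, key u hu, key v hv⟩

variable [Fintype ι]

/-- The lattice points of the face of `[0,N]^ι` spanned by the directions `S` in which all other
coordinates are `N`, restricted to least vertices of unit cubes. -/
def faceBox (N : ℕ) (S : Finset ι) : Finset (ι → ℕ) :=
  Fintype.piFinset fun i => if i ∈ S then Finset.range N else {N}

lemma sum_faceBox (N : ℕ) {S : Finset ι} {a : ι} (ha : a ∈ S) (f : (ι → ℕ) → ZMod 2) :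
    ∑ x ∈ faceBox N S, f x
      = ∑ y ∈ faceBox N (S.erase a), ∑ t ∈ Finset.range N, f (Function.update y a t) := by
  rw [Finset.sum_sigma']
  refine Finset.sum_bij' (fun x _ => ⟨Function.update x a N, x a⟩)
    (fun p _ => Function.update p.1 a p.2) ?_ ?_ ?_ ?_ ?_
  · intro x hx
    simp only [faceBox, Finset.mem_sigma, Fintype.mem_piFinset] at hx ⊢
    refine ⟨fun j => ?_, by simpa [ha] using hx a⟩
    by_cases hj : j = a
    · subst hj; simp
    · simpa [hj] using hx j
  · rintro ⟨y, t⟩ hy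
    simp only [faceBox, Finset.mem_sigma, Fintype.mem_piFinset] at hy ⊢
    intro j
    by_cases hj : j = a
    · subst hj; simpa [ha] using hy.2
    · simpa [hj] using hy.1 j
  · intro x _; simp
  · rintro ⟨y, t⟩ hy
    simp only [faceBox, Finset.mem_sigma, Fintype.mem_piFinset] at hy
    have h : y a = N := by simpa using hy.1 a
    simp [← h]
  · intro x _; simp

/-- Discrete Stokes formula: differences in direction `a` telescope along each line, leaving the two
opposite faces. -/
lemma sum_faceBox_sub (N : ℕ) {S : Finset ι} {a : ι} (ha : a ∈ S) (f : (ι → ℕ) → ZMod 2) :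
    ∑ x ∈ faceBox N S, (f (x + Pi.single a 1) - f x)
      = ∑ y ∈ faceBox N (S.erase a), (f y - f (Function.update y a 0)) := by
  rw [sum_faceBox N ha]
  refine Finset.sum_congr rfl fun y hy => ?_
  have hya : y a = N := by
    simpa using (Fintype.mem_piFinset.mp hy) a
  have h : ∀ t, Function.update y a t + Pi.single a 1 = Function.update y a (t + 1) := by
    intro t; ext j
    by_cases hj : j = a
    · subst hj; simp
    · simp [hj]
  simp only [h]
  rw [Finset.sum_range_sub fun t => f (Function.update y a t)]
  congr 2
  simp [← hya]

/-- If label `i` is `0` on the face `x i = 0` and `1` on the face `x i = N`, the number of cubes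
detected by the cup product is odd. -/
lemma sum_cup_eq_one (N : ℕ) (l : ι → (ι → ℕ) → ZMod 2)
    (h0 : ∀ i x, x i = 0 → l i x = 0) (h1 : ∀ i x, x i = N → l i x = 1) (L : List ι)
    (hL : L.Nodup) : ∑ x ∈ faceBox N L.toFinset, cup l L L.toFinset x = 1 := by
  induction L with
  | nil => simp [faceBox, cup]
  | cons i L ih =>
    obtain ⟨hiL, hL'⟩ := List.nodup_cons.mp hL
    have hi : i ∉ L.toFinset := by simpa using hiL
    simp only [cup_cons_eq]
    rw [Finset.sum_comm]
    -- Only the pair of faces orthogonal to `i` contributes: label `i` is 1 on the upper face, which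
    -- gives the previous count, and 0 on the lower one.
    have step : ∀ a ∈ (i :: L).toFinset,
        ∑ x ∈ faceBox N (i :: L).toFinset,
          (l i (x + Pi.single a 1) * cup l L ((i :: L).toFinset.erase a) (x + Pi.single a 1)
            - l i x * cup l L ((i :: L).toFinset.erase a) x) = if a = i then 1 else 0 := by
      intro a ha
      rw [sum_faceBox_sub N ha fun x => l i x * cup l L ((i :: L).toFinset.erase a) x]
      split_ifs with hai
      · subst hai
        have e : (a :: L).toFinset.erase a = L.toFinset := by
          rw [List.toFinset_cons, Finset.erase_insert hi]
        rw [e, ← ih hL']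
        refine Finset.sum_congr rfl fun y hy => ?_
        have hya : y a = N := by
          have := (Fintype.mem_piFinset.mp hy) a
          simpa [hiL] using this
        rw [h1 a y hya, h0 a _ (Function.update_self ..)]
        simp
      · have haL : a ∈ L := by simpa [hai] using ha
        -- On a face orthogonal to `a ∈ L` label `a` is constant, so the remaining product vanishes.
        have van : ∀ x : ι → ℕ, x a = 0 ∨ x a = N →
            cup l L ((i :: L).toFinset.erase a) x = 0 := by
          intro x hx
          by_contra hne
          obtain ⟨u, v, huv, hu, hv⟩ := exists_label_ne_of_cup_ne_zero l hne haL
          have hu := hu a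
          have hv := hv a
          simp only [Finset.mem_erase, ne_eq, not_true_eq_false, false_and, if_false,
            add_zero] at hu hv
          apply huv
          rcases hx with hx | hx
          · rw [h0 a u (by omega), h0 a v (by omega)]
          · rw [h1 a u (by omega), h1 a v (by omega)]
        refine Finset.sum_eq_zero fun y hy => ?_
        have hya : y a = N := by
          simpa using (Fintype.mem_piFinset.mp hy) a
        rw [van y (Or.inr hya), van _ (Or.inl (Function.update_self ..))]
        simp
    rw [Finset.sum_congr rfl step]
    simp

/-- **Kuhn's lemma.** Some unit cube of the lattice carries both values of every label. -/
lemma exists_cube_all_labels (N : ℕ) (l : ι → (ι → ℕ) → ZMod 2)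
    (h0 : ∀ i x, x i = 0 → l i x = 0) (h1 : ∀ i x, x i = N → l i x = 1) :
    ∃ x : ι → ℕ, (∀ i, x i < N) ∧ ∀ i, ∃ u v : ι → ℕ, l i u ≠ l i v ∧
      (∀ j, x j ≤ u j ∧ u j ≤ x j + 1) ∧ (∀ j, x j ≤ v j ∧ v j ≤ x j + 1) := by
  have hL := sum_cup_eq_one N l h0 h1 Finset.univ.toList (Finset.nodup_toList _)
  rw [Finset.toList_toFinset] at hL
  obtain ⟨x, hx, hne⟩ := Finset.exists_ne_zero_of_sum_ne_zero (hL ▸ one_ne_zero)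
  refine ⟨x, fun i => by simpa using (Fintype.mem_piFinset.mp hx) i, fun i => ?_⟩
  simpa using exists_label_ne_of_cup_ne_zero l hne (i := i) (by simp)

end Kuhn

/-! ### Approximate fixed points -/

/-- The point `x / N` of the cube, for a lattice point `x` (clamped to the cube). -/
noncomputable def latticePoint (N : ℕ) {n : ℕ} (x : Fin n → ℕ) : Cube n :=
  ⟨fun i => min ((x i : ℝ) / N) 1, fun _ => ⟨le_min (by positivity) zero_le_one, min_le_right _ _⟩⟩

lemma latticePoint_apply {N n : ℕ} {x : Fin n → ℕ} {i : Fin n} (hx : x i ≤ N) :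
    (latticePoint N x).1 i = (x i : ℝ) / N :=
  min_eq_left (div_le_one_of_le₀ (by exact_mod_cast hx) (by positivity))

/-- A self-map of the cube with a linear modulus of continuity in the max norm has approximate
fixed points. -/
lemma exists_approx_fixed_point {n : ℕ} (f : Cube n → Cube n) {c : ℝ} (hc : 0 ≤ c)
    (hf : ∀ (x y : Cube n) (d : ℝ), (∀ i, |x.1 i - y.1 i| ≤ d) → ∀ i, |(f x).1 i - (f y).1 i| ≤ c * d)
    {η : ℝ} (hη : 0 < η) : ∃ x : Cube n, ∀ i, |(f x).1 i - x.1 i| ≤ η := by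
  classical
  obtain ⟨N, hN⟩ := exists_nat_gt ((c + 1) / η)
  have hN0 : (0 : ℝ) < N := lt_of_le_of_lt (by positivity) hN
  have hNη : (c + 1) / N ≤ η := by
    rw [div_le_iff₀ hN0]
    rw [div_lt_iff₀ hη] at hN
    linarith
  have hNpos : 0 < N := by exact_mod_cast hN0
  -- Label 1 means that coordinate `i` does not increase. The value 0 is imposed on the lower face,
  -- where the coordinate cannot decrease, so label 0 always means that it does not decrease.
  let l : Fin n → (Fin n → ℕ) → ZMod 2 := fun i x =>
    if x i = 0 then 0 else if (f (latticePoint N x)).1 i ≤ (latticePoint N x).1 i then 1 else 0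
  obtain ⟨x, hxN, hx⟩ := exists_cube_all_labels N l (fun i x h => by simp [l, h]) (fun i x h => by
    have h1 : (latticePoint N x).1 i = 1 := by
      rw [latticePoint_apply h.le, h, div_self hN0.ne']
    have h2 := ((f (latticePoint N x)).2 i).2
    have h3 : x i ≠ 0 := by omega
    simp only [l, if_neg h3, h1, if_pos h2])
  refine ⟨latticePoint N x, fun i => ?_⟩
  have close : ∀ u : Fin n → ℕ, (∀ j, x j ≤ u j ∧ u j ≤ x j + 1) →
      ∀ j, (latticePoint N x).1 j ≤ (latticePoint N u).1 j ∧
        (latticePoint N u).1 j ≤ (latticePoint N x).1 j + 1 / N := by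
    intro u hu j
    have h1 := hxN j
    have h2 := hu j
    rw [latticePoint_apply h1.le, latticePoint_apply (by omega), ← add_div]
    constructor
    · gcongr; exact h2.1
    · gcongr; exact_mod_cast h2.2
  have fclose : ∀ u : Fin n → ℕ, (∀ j, x j ≤ u j ∧ u j ≤ x j + 1) →
      |(f (latticePoint N x)).1 i - (f (latticePoint N u)).1 i| ≤ c * (1 / N) := by
    intro u hu
    refine hf _ _ _ (fun j => ?_) i
    have := close u hu j
    rw [abs_le]
    constructor <;> linarith
  -- The displacement is nonnegative at `u` and nonpositive at `v`; moving from either to `x`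
  -- changes it by at most `(c + 1) / N`.
  have main : ∀ u v : Fin n → ℕ, (∀ j, x j ≤ u j ∧ u j ≤ x j + 1) →
      (∀ j, x j ≤ v j ∧ v j ≤ x j + 1) → l i u = 0 → l i v ≠ 0 →
      |(f (latticePoint N x)).1 i - (latticePoint N x).1 i| ≤ η := by
    intro u v hu hv hlu hlv
    have hfu : (latticePoint N u).1 i ≤ (f (latticePoint N u)).1 i := by
      by_cases hu0 : u i = 0
      · rw [latticePoint_apply (by omega), hu0]
        simpa using ((f (latticePoint N u)).2 i).1
      · by_contra hlt
        simp [l, hu0, (not_le.mp hlt).le] at hlu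
    have hfv : (f (latticePoint N v)).1 i ≤ (latticePoint N v).1 i := by
      by_contra hlt
      simp [l, hlt] at hlv
    have h1 := close u hu i
    have h2 := close v hv i
    have h3 := abs_le.mp (fclose u hu)
    have h4 := abs_le.mp (fclose v hv)
    have h5 : c * (1 / N) + 1 / N ≤ η := by
      rw [← add_one_mul, mul_one_div]; exact hNη
    have h6 : (0 : ℝ) ≤ 1 / N := by positivity
    rw [abs_le]
    constructor <;> linarith
  obtain ⟨u, v, huv, hu, hv⟩ := hx i
  by_cases hlu : l i u = 0
  · exact main u v hu hv hlu fun h => huv (hlu.trans h.symm)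
  · refine main v u hv hu ?_ hlu
    by_contra hlv
    have two : ∀ a b : ZMod 2, a ≠ 0 → b ≠ 0 → a = b := by decide
    exact huv (two _ _ hlu hlv)

end BrouwerComm

namespace BrouwerComm

/-! ### The normalized norm -/

lemma toReal_one_le {p : ℝ≥0∞} (hp : 1 ≤ p) (hp' : p ≠ ∞) : 1 ≤ p.toReal := by
  simpa using ENNReal.toReal_mono hp' hp

lemma pNorm_nonneg (p : ℝ≥0∞) {n : ℕ} (x : Fin n → ℝ) : 0 ≤ pNorm p x := by
  unfold pNorm
  split_ifs
  · exact Real.iSup_nonneg fun i => abs_nonneg _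
  · positivity

lemma pNorm_le_iff {p : ℝ≥0∞} (hp : 1 ≤ p) (hp' : p ≠ ∞) {n : ℕ} (hn : 0 < n) (x : Fin n → ℝ)
    {t : ℝ} (ht : 0 ≤ t) : pNorm p x ≤ t ↔ ∑ i, |x i| ^ p.toReal ≤ n * t ^ p.toReal := by
  have hq : 0 < p.toReal := zero_lt_one.trans_le (toReal_one_le hp hp')
  have hn' : (0 : ℝ) < n := by exact_mod_cast hn
  rw [pNorm, if_neg hp', one_div p.toReal, Real.rpow_inv_le_iff_of_pos (by positivity) ht hq,
    one_div, inv_mul_le_iff₀ hn']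

lemma pNorm_top_le {n : ℕ} {x : Fin n → ℝ} {t : ℝ} (ht : 0 ≤ t) (h : ∀ i, |x i| ≤ t) :
    pNorm ∞ x ≤ t := by
  rw [pNorm, if_pos rfl]
  exact Real.iSup_le h ht

lemma abs_le_pNorm_top {n : ℕ} (x : Fin n → ℝ) (i : Fin n) : |x i| ≤ pNorm ∞ x := by
  rw [pNorm, if_pos rfl]
  exact le_ciSup (f := fun i => |x i|) (Set.finite_range _).bddAbove i

lemma pNorm_dim_zero {p : ℝ≥0∞} (hp : 1 ≤ p) (x : Fin 0 → ℝ) : pNorm p x = 0 := by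
  unfold pNorm
  split_ifs with h
  · simp
  · have := toReal_one_le hp h
    simp only [Finset.univ_eq_empty, Finset.sum_empty, mul_zero]
    exact Real.zero_rpow (by positivity)

lemma pNorm_mono {p : ℝ≥0∞} (hp : 1 ≤ p) {n : ℕ} {x y : Fin n → ℝ} (h : ∀ i, |x i| ≤ |y i|) :
    pNorm p x ≤ pNorm p y := by
  rcases eq_or_ne p ∞ with rfl | hp'
  · exact pNorm_top_le (pNorm_nonneg _ _) fun i => (h i).trans (abs_le_pNorm_top y i)
  · have := toReal_one_le hp hp'
    rw [pNorm, pNorm, if_neg hp', if_neg hp']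
    have key := Finset.sum_le_sum fun i (_ : i ∈ Finset.univ) =>
      Real.rpow_le_rpow (abs_nonneg (x i)) (h i) (zero_le_one.trans this)
    gcongr

lemma pNorm_le_of_abs_le {p : ℝ≥0∞} (hp : 1 ≤ p) {n : ℕ} {x : Fin n → ℝ} {t : ℝ} (ht : 0 ≤ t)
    (h : ∀ i, |x i| ≤ t) : pNorm p x ≤ t := by
  rcases eq_or_ne p ∞ with rfl | hp'
  · exact pNorm_top_le ht h
  rcases n.eq_zero_or_pos with rfl | hn
  · rwa [pNorm_dim_zero hp]
  rw [pNorm_le_iff hp hp' hn x ht]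
  have := toReal_one_le hp hp'
  calc ∑ i, |x i| ^ p.toReal ≤ ∑ _i : Fin n, t ^ p.toReal := by
        gcongr with i; exact h i
    _ = n * t ^ p.toReal := by simp

/-- The factor `n` is crude but harmless: it only serves the existence of approximate fixed points
and never enters the mesh of the protocol's grid. -/
lemma abs_le_mul_pNorm {p : ℝ≥0∞} (hp : 1 ≤ p) {n : ℕ} (x : Fin n → ℝ) (i : Fin n) :
    |x i| ≤ n * pNorm p x := by
  have hn : 0 < n := i.pos
  have hn1 : (1 : ℝ) ≤ n := by exact_mod_cast hn
  have h0 := pNorm_nonneg p x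
  rcases eq_or_ne p ∞ with rfl | hp'
  · exact (abs_le_pNorm_top x i).trans (le_mul_of_one_le_left h0 hn1)
  have hq := toReal_one_le hp hp'
  have h := (pNorm_le_iff hp hp' hn x h0).mp le_rfl
  have h1 : |x i| ^ p.toReal ≤ ∑ i, |x i| ^ p.toReal :=
    Finset.single_le_sum (f := fun i => |x i| ^ p.toReal) (fun _ _ => by positivity)
      (Finset.mem_univ i)
  have h2 : (n : ℝ) ≤ (n : ℝ) ^ p.toReal := Real.self_le_rpow_of_one_le hn1 hq
  rw [← Real.rpow_le_rpow_iff (abs_nonneg _) (by positivity) (zero_lt_one.trans_le hq),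
    Real.mul_rpow (by positivity) h0]
  exact h1.trans (h.trans (by gcongr))

lemma pNorm_add_le {p : ℝ≥0∞} (hp : 1 ≤ p) {n : ℕ} (x y : Fin n → ℝ) :
    pNorm p (x + y) ≤ pNorm p x + pNorm p y := by
  rcases eq_or_ne p ∞ with rfl | hp'
  · exact pNorm_top_le (add_nonneg (pNorm_nonneg _ _) (pNorm_nonneg _ _)) fun i =>
      (abs_add_le _ _).trans (add_le_add (abs_le_pNorm_top x i) (abs_le_pNorm_top y i))
  · have h := Real.Lp_add_le Finset.univ x y (toReal_one_le hp hp')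
    simp only [pNorm, if_neg hp']
    rw [Real.mul_rpow (by positivity) (by positivity), Real.mul_rpow (by positivity) (by positivity),
      Real.mul_rpow (by positivity) (by positivity), ← mul_add]
    exact mul_le_mul_of_nonneg_left h (by positivity)

lemma pNorm_sub_le {p : ℝ≥0∞} (hp : 1 ≤ p) {n : ℕ} (x y z : Fin n → ℝ) :
    pNorm p (x - z) ≤ pNorm p (x - y) + pNorm p (y - z) := by
  simpa using pNorm_add_le hp (x - y) (y - z)

/-- Thanks to the normalization, the `p`-th power of the norm of a concatenation is the average of
those of its halves. -/
lemma pNorm_append_le {p : ℝ≥0∞} (hp : 1 ≤ p) {k : ℕ} {x y : Fin k → ℝ} {t : ℝ}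
    (hx : pNorm p x ≤ t) (hy : pNorm p y ≤ t) : pNorm p (Fin.append x y) ≤ t := by
  have ht := (pNorm_nonneg p x).trans hx
  rcases eq_or_ne p ∞ with rfl | hp'
  · refine pNorm_top_le ht fun i => ?_
    refine Fin.addCases (fun j => ?_) (fun j => ?_) i
    · rw [Fin.append_left]; exact (abs_le_pNorm_top x j).trans hx
    · rw [Fin.append_right]; exact (abs_le_pNorm_top y j).trans hy
  rcases k.eq_zero_or_pos with rfl | hk
  · rwa [pNorm_dim_zero hp]
  rw [pNorm_le_iff hp hp' hk _ ht] at hx hy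
  rw [pNorm_le_iff hp hp' (by omega) _ ht, Fin.sum_univ_add]
  simp only [Fin.append_left, Fin.append_right]
  push_cast
  linarith

lemma append_sub_append {k : ℕ} (a b c d : Fin k → ℝ) :
    Fin.append a b - Fin.append c d = Fin.append (a - c) (b - d) := by
  ext i
  refine Fin.addCases (fun j => ?_) (fun j => ?_) i <;>
    simp only [Pi.sub_apply, Fin.append_left, Fin.append_right]

/-! ### Lipschitz maps of the cube -/

lemma IsLipschitz.exists_approx_fixed_point {p : ℝ≥0∞} (hp : 1 ≤ p) {c : ℝ} (hc : 0 ≤ c) {n : ℕ}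
    {f : Cube n → Cube n} (hf : IsLipschitz p c f) {η : ℝ} (hη : 0 < η) :
    ∃ x : Cube n, ∀ i, |(f x).1 i - x.1 i| ≤ η := by
  refine BrouwerComm.exists_approx_fixed_point f (c := n * c) (by positivity) ?_ hη
  intro x y d hd i
  have hd0 : 0 ≤ d := (abs_nonneg _).trans (hd i)
  calc |(f x).1 i - (f y).1 i| ≤ n * pNorm p ((f x).1 - (f y).1) :=
        abs_le_mul_pNorm hp ((f x).1 - (f y).1) i
    _ ≤ n * (c * d) := by
        gcongr
        exact (hf x y).trans (by gcongr; exact pNorm_le_of_abs_le hp hd0 hd)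
    _ = n * c * d := by ring

/-- The grid `{0, 1/N, …, 1}ⁿ`. -/
abbrev Grid (N n : ℕ) : Type := Fin n → Fin (N + 1)

/-- A grid point as a point of the cube. -/
noncomputable def Grid.point {N n : ℕ} (g : Grid N n) : Cube n := latticePoint N fun i => (g i : ℕ)

lemma exists_grid_point_near {N : ℕ} (hN : 0 < N) {n : ℕ} (x : Cube n) :
    ∃ g : Grid N n, ∀ i, |x.1 i - g.point.1 i| ≤ 1 / N := by
  have hN' : (0 : ℝ) < N := by exact_mod_cast hN
  have hle : ∀ i, ⌊x.1 i * N⌋₊ ≤ N := fun i =>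
    Nat.floor_le_of_le (mul_le_of_le_one_left hN'.le (x.2 i).2)
  refine ⟨fun i => ⟨⌊x.1 i * N⌋₊, Nat.lt_succ_of_le (hle i)⟩, fun i => ?_⟩
  rw [Grid.point, latticePoint_apply (hle i)]
  have h1 := Nat.floor_le (mul_nonneg (x.2 i).1 hN'.le)
  have h2 := (Nat.lt_floor_add_one (x.1 i * N)).le
  have h3 : x.1 i - (⌊x.1 i * N⌋₊ : ℝ) / N = (x.1 i * N - ⌊x.1 i * N⌋₊) / N := by
    field_simp
  rw [h3, abs_of_nonneg (div_nonneg (by linarith) hN'.le)]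
  gcongr
  linarith

/-- Of the error `(c + 2) / N`, one `1/N` is the defect of the real approximate fixed point, another
the move to the grid, and `c / N` the resulting change of `f`. -/
lemma IsLipschitz.exists_grid_approx_fixed_point {p : ℝ≥0∞} (hp : 1 ≤ p) {c : ℝ} (hc : 0 ≤ c)
    {n : ℕ} {f : Cube n → Cube n} (hf : IsLipschitz p c f) {N : ℕ} (hN : 0 < N) :
    ∃ g : Grid N n, pNorm p ((f g.point).1 - g.point.1) ≤ (c + 2) / N := by
  have hN' : (0 : ℝ) < 1 / N := by positivity
  obtain ⟨x, hx⟩ := hf.exists_approx_fixed_point hp hc hN'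
  obtain ⟨g, hg⟩ := exists_grid_point_near hN x
  refine ⟨g, ?_⟩
  have h1 : pNorm p ((f g.point).1 - (f x).1) ≤ c * (1 / N) := by
    refine (hf _ _).trans ?_
    gcongr
    refine pNorm_le_of_abs_le hp hN'.le fun i => ?_
    rw [Pi.sub_apply, abs_sub_comm]
    exact hg i
  have h2 : pNorm p ((f x).1 - x.1) ≤ 1 / N := pNorm_le_of_abs_le hp hN'.le hx
  have h3 : pNorm p (x.1 - g.point.1) ≤ 1 / N := pNorm_le_of_abs_le hp hN'.le hg
  have h4 := pNorm_sub_le hp (f g.point).1 (f x).1 g.point.1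
  have h5 := pNorm_sub_le hp (f x).1 x.1 g.point.1
  have h6 : (c + 2) / N = c * (1 / N) + 1 / N + 1 / N := by ring
  linarith

lemma isLipschitz_compMap {p : ℝ≥0∞} {a b : ℝ} (hb : 0 ≤ b) {n m : ℕ}
    {fA : Cube n → Cube m} {fB : Cube m → Cube n} (hA : IsLipschitz p a fA)
    (hB : IsLipschitz p b fB) : IsLipschitz p (b * a) (compMap fA fB) := fun x y => by
  rw [mul_assoc]
  exact (hB _ _).trans (mul_le_mul_of_nonneg_left (hA x y) hb)

lemma isLipschitz_concatMap {p : ℝ≥0∞} (hp : 1 ≤ p) {a b : ℝ} (ha : 0 ≤ a) (hb : 0 ≤ b) {k : ℕ}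
    {fA fB : Cube (k + k) → Cube k} (hA : IsLipschitz p a fA) (hB : IsLipschitz p b fB) :
    IsLipschitz p (a + b) (concatMap fA fB) := fun x y => by
  have h0 := pNorm_nonneg p (x.1 - y.1)
  simp only [concatMap, append_sub_append]
  exact pNorm_append_le hp ((hA x y).trans (by gcongr; linarith))
    ((hB x y).trans (by gcongr; linarith))

lemma pNorm_half_add_le {p : ℝ≥0∞} (hp : 1 ≤ p) {n : ℕ} (x y x' y' : Fin n → ℝ) :
    pNorm p ((fun i => (x i + y i) / 2) - fun i => (x' i + y' i) / 2)
      ≤ pNorm p (x - x') + pNorm p (y - y') := by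
  refine (pNorm_mono hp fun i => ?_).trans (pNorm_add_le hp _ _)
  have h : ((fun i => (x i + y i) / 2) - fun i => (x' i + y' i) / 2) i
      = ((x - x' + (y - y')) i) / 2 := by
    simp only [Pi.sub_apply, Pi.add_apply]; ring
  rw [h, abs_div, abs_two]
  exact half_le_self (abs_nonneg _)

lemma isLipschitz_meanMap {p : ℝ≥0∞} (hp : 1 ≤ p) {a b : ℝ} {n : ℕ}
    {fA fB : Cube n → Cube n} (hA : IsLipschitz p a fA) (hB : IsLipschitz p b fB) :
    IsLipschitz p (a + b) (meanMap fA fB) := fun x y => by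
  rw [add_mul]
  exact (pNorm_half_add_le hp _ _ _ _).trans (add_le_add (hA x y) (hB x y))

/-! ### Protocols sending one message each way -/

/-- Alice announces `b` bits determined by her input, then the players continue. -/
lemma Protocol.exists_alice_announce {X Y Z : Type} (b : ℕ) {c : ℕ} (s : X → Fin b → Bool)
    (P : (Fin b → Bool) → Protocol X Y Z) (hP : ∀ w, (P w).cost ≤ c) :
    ∃ Q : Protocol X Y Z, Q.cost ≤ b + c ∧ ∀ x y, Q.run x y = (P (s x)).run x y := by
  induction b with
  | zero =>
    exact ⟨P Fin.elim0, by simpa using hP _, fun x y => by rw [Subsingleton.elim (s x) Fin.elim0]⟩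
  | succ b ih =>
    choose Q hQc hQ using fun t : Bool =>
      ih (fun x => Fin.tail (s x)) (fun w => P (Fin.cons t w)) fun w => hP _
    refine ⟨.alice (fun x => s x 0) Q, ?_, fun x y => ?_⟩
    · have h1 := hQc false
      have h2 := hQc true
      simp only [Protocol.cost]
      omega
    · rw [Protocol.run, hQ, Fin.cons_self_tail]

/-- Bob announces `b` bits determined by his input, then the players continue. -/
lemma Protocol.exists_bob_announce {X Y Z : Type} (b : ℕ) {c : ℕ} (s : Y → Fin b → Bool)
    (P : (Fin b → Bool) → Protocol X Y Z) (hP : ∀ w, (P w).cost ≤ c) :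
    ∃ Q : Protocol X Y Z, Q.cost ≤ b + c ∧ ∀ x y, Q.run x y = (P (s y)).run x y := by
  induction b with
  | zero =>
    exact ⟨P Fin.elim0, by simpa using hP _, fun x y => by rw [Subsingleton.elim (s y) Fin.elim0]⟩
  | succ b ih =>
    choose Q hQc hQ using fun t : Bool =>
      ih (fun y => Fin.tail (s y)) (fun w => P (Fin.cons t w)) fun w => hP _
    refine ⟨.bob (fun y => s y 0) Q, ?_, fun x y => ?_⟩
    · have h1 := hQc false
      have h2 := hQc true
      simp only [Protocol.cost]
      omega
    · rw [Protocol.run, hQ, Fin.cons_self_tail]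

lemma exists_bits_leftInverse (α : Type) [Fintype α] [Nonempty α] {b : ℕ}
    (h : Fintype.card α ≤ 2 ^ b) :
    ∃ (e : α → Fin b → Bool) (d : (Fin b → Bool) → α), Function.LeftInverse d e := by
  obtain ⟨e⟩ : Nonempty (α ↪ (Fin b → Bool)) :=
    Function.Embedding.nonempty_of_card_le (by simpa using h)
  exact ⟨e, Function.invFun e, Function.leftInverse_invFun e.injective⟩

/-- Alice sends a message from `α`, Bob answers with a message from `β` that names the output. -/
lemma detCC_le_of_messages {X Y Z α β : Type} [Fintype α] [Fintype β] [Nonempty α] [Nonempty β]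
    {R : X → Y → Z → Prop} (s : X → α) (t : α → Y → β) (out : β → Z)
    (h : ∀ x y, R x y (out (t (s x) y))) {b c : ℕ} (hα : Fintype.card α ≤ 2 ^ b)
    (hβ : Fintype.card β ≤ 2 ^ c) : detCC R ≤ ((b + c : ℕ) : ℕ∞) := by
  obtain ⟨e, d, hed⟩ := exists_bits_leftInverse α hα
  obtain ⟨e', d', hed'⟩ := exists_bits_leftInverse β hβ
  choose P hPc hP using fun w : Fin b → Bool =>
    Protocol.exists_bob_announce (X := X) (c := 0) c (fun y => e' (t (d w) y))
      (fun v => Protocol.output (out (d' v))) fun _ => le_rfl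
  obtain ⟨Q, hQc, hQ⟩ := Protocol.exists_alice_announce b (fun x => e (s x)) P hPc
  refine (iInf₂_le Q fun x y => ?_).trans (by exact_mod_cast hQc)
  rw [hQ, hP, hed, Protocol.run, hed']
  exact h x y

/-- Alice sends a rounded table of her function on a grid, and Bob answers with a grid point. Here
`Φ y z v` is the value at `z` of the combined function when Alice's function takes the value `v`. -/
lemma detCC_le_of_table {p : ℝ≥0∞} (hp : 1 ≤ p) {X Y : Type} {n m N : ℕ} (hN : 0 < N)
    {eps c : ℝ} (hc : 0 ≤ c) (hcN : (3 * c + 2) / N ≤ eps) (val : X → Cube n → Cube m)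
    (Φ : Y → Cube n → Cube m → Cube n)
    (hΦ : ∀ y z v v', pNorm p ((Φ y z v).1 - (Φ y z v').1) ≤ c * pNorm p (v.1 - v'.1))
    (hlip : ∀ x y, IsLipschitz p c fun z => Φ y z (val x z)) :
    detCC (fun x y z => IsApproxFixedPoint p eps (fun z => Φ y z (val x z)) z)
      ≤ ((N * m * (N + 1) ^ n + N * n : ℕ) : ℕ∞) := by
  have hN' : (0 : ℝ) ≤ 1 / N := by positivity
  -- Each grid coordinate is charged `N` bits, which is wasteful but constant.
  have hbase : N + 1 ≤ 2 ^ N := Nat.lt_two_pow_self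
  choose s hs using fun (x : X) (g : Grid N n) => exists_grid_point_near hN (val x g.point)
  have hround : ∀ x y g, pNorm p ((Φ y g.point (val x g.point)).1 - (Φ y g.point (s x g).point).1)
      ≤ c * (1 / N) := fun x y g => (hΦ _ _ _ _).trans <|
    mul_le_mul_of_nonneg_left (pNorm_le_of_abs_le hp hN' (hs x g)) hc
  -- The threshold is the true defect `(c + 2) / N` plus the rounding error `c / N`; returning to
  -- the exact values costs a further `c / N`, whence `3 * c + 2`.
  let good (q : Grid N n → Grid N m) (y : Y) (g : Grid N n) : Prop :=
    pNorm p ((Φ y g.point (q g).point).1 - g.point.1) ≤ (2 * c + 2) / N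
  refine detCC_le_of_messages (α := Grid N n → Grid N m) (β := Grid N n) s
    (fun q y => Classical.epsilon (good q y)) Grid.point (fun x y => ?_) ?_ ?_
  · have hex : ∃ g, good (s x) y g := by
      obtain ⟨g, hg⟩ := (hlip x y).exists_grid_approx_fixed_point hp hc hN
      refine ⟨g, ?_⟩
      have h1 := hround x y g
      have h2 := pNorm_sub_le hp (Φ y g.point (s x g).point).1 (Φ y g.point (val x g.point)).1
        g.point.1
      have h3 : pNorm p ((Φ y g.point (s x g).point).1 - (Φ y g.point (val x g.point)).1)
          ≤ c * (1 / N) := (pNorm_mono hp fun i => by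
            rw [Pi.sub_apply, Pi.sub_apply, abs_sub_comm]).trans h1
      have h4 : (2 * c + 2) / N = c * (1 / N) + (c + 2) / N := by ring
      simp only [good]
      linarith
    have hg := Classical.epsilon_spec hex
    set g := Classical.epsilon (good (s x) y)
    have h1 := hround x y g
    have h2 := pNorm_sub_le hp (Φ y g.point (val x g.point)).1 (Φ y g.point (s x g).point).1
      g.point.1
    have h3 : (3 * c + 2) / N = c * (1 / N) + (2 * c + 2) / N := by ring
    simp only [good] at hg
    simp only [IsApproxFixedPoint]
    linarith
  · simp only [Fintype.card_fun, Fintype.card_fin]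
    rw [← pow_mul, mul_assoc, pow_mul 2 N]
    exact Nat.pow_le_pow_left hbase _
  · simp only [Fintype.card_fun, Fintype.card_fin]
    rw [pow_mul]
    exact Nat.pow_le_pow_left hbase _

lemma table_cost_le {N K n m : ℕ} (hn : 1 ≤ n) (hm : m ≤ K * n) :
    N * m * (N + 1) ^ n + N * n ≤ 2 ^ ((2 * N + K + 2) * n) := by
  have hN : N ≤ 2 ^ (N * n) := Nat.lt_two_pow_self.le.trans
    (Nat.pow_le_pow_right two_pos (Nat.le_mul_of_pos_right N hn))
  have hm' : m ≤ 2 ^ (K * n) := hm.trans Nat.lt_two_pow_self.le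
  have hG : (N + 1) ^ n ≤ 2 ^ (N * n) := by
    rw [pow_mul]; exact Nat.pow_le_pow_left Nat.lt_two_pow_self n
  have hn' : n ≤ 2 ^ n := Nat.lt_two_pow_self.le
  calc N * m * (N + 1) ^ n + N * n
      ≤ 2 ^ (N * n) * 2 ^ (K * n) * 2 ^ (N * n) + 2 ^ (N * n) * 2 ^ n := by gcongr
    _ = 2 ^ ((2 * N + K) * n) + 2 ^ ((N + 1) * n) := by
        simp only [← pow_add]; ring_nf
    _ ≤ 2 ^ ((2 * N + K + 1) * n) + 2 ^ ((2 * N + K + 1) * n) := by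
        exact add_le_add
          (Nat.pow_le_pow_right two_pos (Nat.mul_le_mul_right n (by omega)))
          (Nat.pow_le_pow_right two_pos (Nat.mul_le_mul_right n (by omega)))
    _ = 2 ^ ((2 * N + K + 1) * n + 1) := by ring
    -- The extra bit is absorbed because `1 ≤ n`.
    _ ≤ 2 ^ ((2 * N + K + 2) * n) := by
        gcongr
        · norm_num
        · nlinarith

lemma IsLipschitz.mono {p : ℝ≥0∞} {a b : ℝ} (hab : a ≤ b) {n m : ℕ} {f : Cube n → Cube m}
    (hf : IsLipschitz p a f) : IsLipschitz p b f := fun x y =>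
  (hf x y).trans (mul_le_mul_of_nonneg_right hab (pNorm_nonneg _ _))

end BrouwerComm

open BrouwerComm in
theorem mainTheorem10 (eps lamA lamB : ℝ) (heps : 0 < eps) (hA : 0 < lamA) (hB : 0 < lamB) :
    (∀ K : ℕ, ∃ C : ℕ, ∀ (p : ℝ≥0∞) (n m : ℕ), 1 ≤ p → 1 ≤ n → m ≤ K * n →
      BrouwerComm.detCC (BrouwerComm.CompProblem p n m eps lamA lamB) ≤ ((2 ^ (C * n) : ℕ) : ℕ∞)) ∧
    (∃ C : ℕ, ∀ (p : ℝ≥0∞) (k : ℕ), 1 ≤ p → 1 ≤ k →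
      BrouwerComm.detCC (BrouwerComm.ConcatProblem p k eps lamA lamB) ≤
        ((2 ^ (C * (k + k)) : ℕ) : ℕ∞)) ∧
    (∃ C : ℕ, ∀ (p : ℝ≥0∞) (n : ℕ), 1 ≤ p → 1 ≤ n →
      BrouwerComm.detCC (BrouwerComm.MeanProblem p n eps lamA lamB) ≤
        ((2 ^ (C * n) : ℕ) : ℕ∞)) := by
  -- One constant dominates the Lipschitz constants of all three combined maps; the `+ 1` gives `1 ≤
  -- c`, needed where Alice's value enters the map directly (concatenation and mean).
  obtain ⟨c, hc⟩ : ∃ c, c = lamB * lamA + lamA + lamB + 1 := ⟨_, rfl⟩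
  have hBA : 0 < lamB * lamA := mul_pos hB hA
  have hc0 : 0 ≤ c := by linarith
  obtain ⟨N, hN⟩ := exists_nat_gt ((3 * c + 2) / eps)
  have hN0 : (0 : ℝ) < N := lt_of_le_of_lt (by positivity) hN
  have hNpos : 0 < N := by exact_mod_cast hN0
  have hcN : (3 * c + 2) / N ≤ eps := by
    rw [div_le_iff₀ hN0]
    rw [div_lt_iff₀ heps] at hN
    linarith
  have le_c_mul : ∀ {a t : ℝ}, a ≤ c → 0 ≤ t → a * t ≤ c * t := fun h ht =>
    mul_le_mul_of_nonneg_right h ht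
  refine ⟨fun K => ⟨2 * N + K + 2, fun p n m hp hn hm => ?_⟩,
    ⟨2 * N + 1 + 2, fun p k hp hk => ?_⟩, ⟨2 * N + 1 + 2, fun p n hp hn => ?_⟩⟩
  · refine le_trans ?_ (Nat.cast_le.mpr (table_cost_le (N := N) hn hm))
    exact detCC_le_of_table hp hNpos hc0 hcN (fun fA : LipFun p lamA n m => fA.1)
      (fun (fB : LipFun p lamB m n) _ v => fB.1 v)
      (fun fB _ v v' => (fB.2 v v').trans (le_c_mul (by linarith) (pNorm_nonneg _ _)))
      (fun fA fB => (isLipschitz_compMap hB.le fA.2 fB.2).mono (by linarith))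
  · refine le_trans ?_ (Nat.cast_le.mpr (table_cost_le (N := N) (m := k) (by omega) (by omega)))
    refine detCC_le_of_table hp hNpos hc0 hcN (fun fA : LipFun p lamA (k + k) k => fA.1)
      -- Alice's function is replaced by the constant `v`, since only its value at `z` matters.
      (fun (fB : LipFun p lamB (k + k) k) z v => concatMap (fun _ => v) fB.1 z)
      (fun fB z v v' => ?_)
      (fun fA fB => (isLipschitz_concatMap hp hA.le hB.le fA.2 fB.2).mono (by linarith))
    have h := le_c_mul (show 1 ≤ c by linarith) (pNorm_nonneg p (v.1 - v'.1))
    simp only [concatMap, append_sub_append]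
    refine pNorm_append_le hp (by linarith) ((pNorm_mono hp fun i => ?_).trans (by linarith))
    simp
  · refine le_trans ?_ (Nat.cast_le.mpr (table_cost_le (N := N) (m := n) hn (by omega)))
    refine detCC_le_of_table hp hNpos hc0 hcN (fun fA : LipFun p lamA n n => fA.1)
      (fun (fB : LipFun p lamB n n) z v => meanMap (fun _ => v) fB.1 z)
      (fun fB z v v' => ?_)
      (fun fA fB => (isLipschitz_meanMap hp fA.2 fB.2).mono (by linarith))
    have h := le_c_mul (show 1 ≤ c by linarith) (pNorm_nonneg p (v.1 - v'.1))
    refine (pNorm_half_add_le hp _ _ _ _).trans ?_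
    rw [sub_self, show pNorm p (0 : Fin n → ℝ) = 0 from
      le_antisymm (pNorm_le_of_abs_le hp le_rfl (by simp)) (pNorm_nonneg _ _)]
    linarith
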